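/- **Theorem 3.6.** Let $\mathbf{k}$ be an algebraically closed field of characteristic $p>0$ and let $A_{1,\mathbf{k}}=\mathbf{k}\langle x,y\rangle/(yx-xy-1)$ be the first Weyl algebra, with the Bernstein filtration $F_d=\{\sum_{i+j\le d}a_{ij}x^iy^j\}$, $d\ge 0$. Let $X_p,Y_p$ be the $p\times p$ matrices over $\mathbf{k}$ of the multiplication by $t$ and of $d/dt$ on $\mathbf{k}[t]/(t^p)$, and for $L=\sum a_{ij}x^iy^j\in A_{1,\mathbf{k}}$ let $$\mathrm{Det}_p(L)=\det\Bigl(\sum a_{ij}(X_p+\tilde x I_p)^i(Y_p+\tilde y I_p)^j\Bigr)\in\mathbf{k}[\tilde x,\tilde y].$$ For $0\neq L\in F_d$ this is a non-zero polynomial of degree at most $d$ in $z_1=\tilde x^p$ and $z_2=\tilde y^p$. Let $\mathfrak{C}_d$ be the projective space of planar algebraic curves of degree at most $d$, that is, of non-zero polynomials in $\mathbf{k}[z_1,z_2]$ of total degree at most $d$ modulo $\mathbf{k}^\times$, and let $$\Theta_d:F_d/\mathbf{k}^\times\to\mathfrak{C}_d,\qquad [L]\mapsto[\mathrm{Det}_p(L)],$$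 where $F_d/\mathbf{k}^\times$ is the projective space of non-zero elements of $F_d$ modulo $\mathbf{k}^\times$. The maps $\Theta_d$ are compatible with the inclusions for $d\le d'$; let $$\Theta:A_{1,\mathbf{k}}/\mathbf{k}^\times=\varinjlim_d F_d/\mathbf{k}^\times\to\mathfrak{C}(\mathbb{A}^2_{\mathbf{k}})=\varinjlim_d\mathfrak{C}_d$$ be their direct limit. Then every $\Theta_d$ is a morphism of projective spaces (given by homogeneous polynomials of one degree without common zeros) and is surjective: every planar curve of degree at most $d$ is the image under $\Theta_d$ of some operator of degree at most $d$. Consequently the morphism $\Theta$ is surjective. -/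

import Mathlib

open scoped LinearAlgebra.Projectivization

noncomputable section

/-! ### The first Weyl algebra -/

/-- The defining relation `y x - x y = 1`; the generator `0` is `x`, the generator `1` is `y`. -/
inductive WeylRel (k : Type*) [CommRing k] :
    FreeAlgebra k (Fin 2) → FreeAlgebra k (Fin 2) → Prop
  | comm : WeylRel k
      (FreeAlgebra.ι k 1 * FreeAlgebra.ι k 0 - FreeAlgebra.ι k 0 * FreeAlgebra.ι k 1) 1

/-- The first Weyl algebra `A_{1,k} = k⟨x, y⟩ / (y x - x y - 1)`. -/
abbrev WeylAlgebra (k : Type*) [CommRing k] : Type _ := RingQuot (WeylRel k)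

namespace WeylAlgebra

section Basic

variable (k : Type*) [CommRing k]

/-- The generator `x`. -/
def x : WeylAlgebra k := RingQuot.mkAlgHom k (WeylRel k) (FreeAlgebra.ι k 0)

/-- The generator `y`, that is `d/dx`. -/
def y : WeylAlgebra k := RingQuot.mkAlgHom k (WeylRel k) (FreeAlgebra.ι k 1)

variable {k}

/-- The universal property of the Weyl algebra. -/
def lift {B : Type*} [Ring B] [Algebra k B] (a b : B) (h : b * a - a * b = 1) :
    WeylAlgebra k →ₐ[k] B :=
  RingQuot.liftAlgHom k (s := WeylRel k)
    ⟨FreeAlgebra.lift k ![a, b], by rintro _ _ ⟨⟩; simpa using h⟩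

theorem lift_x {B : Type*} [Ring B] [Algebra k B] (a b : B) (h : b * a - a * b = 1) :
    lift (k := k) a b h (x k) = a := by
  simp [lift, x]

theorem lift_y {B : Type*} [Ring B] [Algebra k B] (a b : B) (h : b * a - a * b = 1) :
    lift (k := k) a b h (y k) = b := by
  simp [lift, y]

theorem hom_ext {B : Type*} [Ring B] [Algebra k B] {f g : WeylAlgebra k →ₐ[k] B}
    (hx : f (x k) = g (x k)) (hy : f (y k) = g (y k)) : f = g := by
  apply RingQuot.ringQuot_ext'
  apply FreeAlgebra.hom_ext
  funext i
  fin_cases i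
  · exact hx
  · exact hy

variable (k)

/-- The Bernstein filtration: `F_d` consists of the operators `∑_{i + j ≤ d} a_{ij} x^i y^j`. -/
def bernstein (d : ℕ) : Submodule k (WeylAlgebra k) :=
  Submodule.span k {L | ∃ i j : ℕ, i + j ≤ d ∧ L = x k ^ i * y k ^ j}

theorem bernstein_mono : Monotone (bernstein k) := fun _ _ h =>
  Submodule.span_mono fun _ ⟨i, j, hij, hL⟩ => ⟨i, j, hij.trans h, hL⟩

instance (d : ℕ) : Module.Finite k (bernstein k d) := by
  refine Module.Finite.span_of_finite k (Set.Finite.subset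
    (((Set.finite_Iic d).prod (Set.finite_Iic d)).image
      fun q : ℕ × ℕ => x k ^ q.1 * y k ^ q.2) ?_)
  rintro _ ⟨i, j, hij, rfl⟩
  exact ⟨(i, j), ⟨by simp; omega, by simp; omega⟩, rfl⟩

end Basic

/-! ### The `p`-determinant -/

/-- Multiplication by `x` on `k[x]/(x^p)`, in the basis `1, x, …, x^(p-1)`. -/
def matX (k : Type*) [CommRing k] (p : ℕ) : Matrix (Fin p) (Fin p) k :=
  Matrix.of fun i j => if (i : ℕ) = j + 1 then 1 else 0

/-- Differentiation on `k[x]/(x^p)` (with `p = 0` in `k`), in the basis `1, x, …, x^(p-1)`. -/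
def matY (k : Type*) [CommRing k] (p : ℕ) : Matrix (Fin p) (Fin p) k :=
  Matrix.of fun i j => if (j : ℕ) = i + 1 then ((j : ℕ) : k) else 0

theorem matY_mul_matX_sub (k : Type*) [CommRing k] (p : ℕ) [CharP k p] :
    matY k p * matX k p - matX k p * matY k p = 1 := by
  ext a b
  have hb := b.2
  have h1 : (matY k p * matX k p) a b =
      if a = b then (if (b : ℕ) + 1 < p then ((b : ℕ) + 1 : k) else 0) else 0 := by
    simp only [matY, matX, Matrix.mul_apply, Matrix.of_apply, mul_ite, mul_one, mul_zero]
    by_cases hp : (b : ℕ) + 1 < p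
    · rw [Finset.sum_eq_single (⟨b + 1, hp⟩ : Fin p)]
      · simp [hp, Fin.ext_iff, eq_comm]
      · intro c _ hc
        rw [if_neg]
        intro h
        exact hc (Fin.ext h)
      · simp
    · rw [Finset.sum_eq_zero]
      · simp [hp]
      · intro c _
        rw [if_neg]
        have := c.2
        omega
  have h2 : (matX k p * matY k p) a b = if a = b then ((b : ℕ) : k) else 0 := by
    simp only [matY, matX, Matrix.mul_apply, Matrix.of_apply, ite_mul, one_mul, zero_mul]
    by_cases ha : (a : ℕ) = 0
    · rw [Finset.sum_eq_zero]
      · split_ifs with hab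
        · subst hab; simp [ha]
        · rfl
      · intro c _
        rw [if_neg]
        omega
    · have ha' := a.2
      rw [Finset.sum_eq_single (⟨a - 1, by omega⟩ : Fin p)]
      · have e : (a : ℕ) - 1 + 1 = a := by omega
        simp only [e, if_true, Fin.ext_iff]
        simp [eq_comm]
      · intro c _ hc
        rw [if_neg]
        intro h
        apply hc
        ext
        simp [h]
      · simp
  rw [Matrix.sub_apply, h1, h2, Matrix.one_apply]
  by_cases hab : a = b
  · simp only [hab, if_true]
    by_cases hp : (b : ℕ) + 1 < p
    · simp [hp]
    · have e : (b : ℕ) + 1 = p := by omega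
      have : ((b : ℕ) : k) + 1 = 0 := by
        rw [← Nat.cast_add_one, e, CharP.cast_eq_zero]
      simp only [hp, if_false]
      linear_combination -this
  · simp [hab]

section PDet

variable (k : Type*) [CommRing k] (p : ℕ) [CharP k p]

open MvPolynomial in
/-- The splitting of the Weyl algebra over the extended centre `k[x̃, ỹ]`
(`x̃ = X 0`, `ỹ = X 1`): the homomorphism to `p × p` matrices over `k[x̃, ỹ]` with
`x ↦ X_p + x̃ I_p` and `y ↦ Y_p + ỹ I_p`. -/
def splitting : WeylAlgebra k →ₐ[k] Matrix (Fin p) (Fin p) (MvPolynomial (Fin 2) k) :=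
  lift ((matX k p).map C + Matrix.scalar (Fin p) (X 0))
    ((matY k p).map C + Matrix.scalar (Fin p) (X 1)) (by
      have h := congrArg (fun M => M.map (C : k →+* MvPolynomial (Fin 2) k))
        (matY_mul_matX_sub k p)
      simp only [Matrix.map_sub _ (map_sub C), Matrix.map_mul,
        Matrix.map_one _ (map_zero C) (map_one C)] at h
      have c0 : ∀ (r : MvPolynomial (Fin 2) k) (M : Matrix (Fin p) (Fin p) _),
          Matrix.scalar (Fin p) r * M = M * Matrix.scalar (Fin p) r := fun r M =>
        (Matrix.scalar_commute r (fun r' => mul_comm _ _) M).eq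
      simp only [add_mul, mul_add, c0 _ ((matX k p).map C), c0 _ ((matY k p).map C),
        c0 (X 1) (Matrix.scalar (Fin p) (X 0))]
      rw [← h]
      abel)

/-- The `p`-determinant
`Det_p (∑ a_{ij} x^i y^j) = det (∑ a_{ij} (X_p + x̃ I_p)^i (Y_p + ỹ I_p)^j)`,
a polynomial in `x̃ = X 0` and `ỹ = X 1`. -/
def pDet (L : WeylAlgebra k) : MvPolynomial (Fin 2) k := (splitting k p L).det

theorem splitting_x : splitting k p (x k) =
    (matX k p).map MvPolynomial.C + Matrix.scalar (Fin p) (MvPolynomial.X 0) := lift_x ..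

theorem splitting_y : splitting k p (y k) =
    (matY k p).map MvPolynomial.C + Matrix.scalar (Fin p) (MvPolynomial.X 1) := lift_y ..

theorem pDet_smul (c : k) (L : WeylAlgebra k) : pDet k p (c • L) = c ^ p • pDet k p L := by
  simp only [pDet, map_smul, Matrix.det_smul_of_tower, Fintype.card_fin]

end PDet

/-! ### The `p`-determinant is a polynomial in `x̃^p` and `ỹ^p` -/

/-- The substitution `X i ↦ X i + ε` over the dual numbers. -/
def dualShift (k : Type*) [CommRing k] (i : Fin 2) :
    MvPolynomial (Fin 2) k →ₐ[k] TrivSqZeroExt (MvPolynomial (Fin 2) k) (MvPolynomial (Fin 2) k) :=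
  MvPolynomial.aeval fun j =>
    TrivSqZeroExt.inl (MvPolynomial.X j) + TrivSqZeroExt.inr (if j = i then 1 else 0)

theorem dualShift_apply (k : Type*) [CommRing k] (i : Fin 2) (f : MvPolynomial (Fin 2) k) :
    dualShift k i f = TrivSqZeroExt.inl f + TrivSqZeroExt.inr (MvPolynomial.pderiv i f) := by
  induction f using MvPolynomial.induction_on with
  | C a => simp [dualShift]; rfl
  | add f g hf hg =>
    simp only [map_add, hf, hg, TrivSqZeroExt.inl_add, TrivSqZeroExt.inr_add]; abel
  | mul_X f j hf =>
    rw [map_mul, hf]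
    by_cases h : j = i
    · subst h
      apply TrivSqZeroExt.ext <;> simp [dualShift, mul_comm, add_comm]
    · apply TrivSqZeroExt.ext <;>
        simp [dualShift, mul_comm, h, MvPolynomial.pderiv_X_of_ne h]

theorem pderiv_pDet_of_conj (k : Type*) [CommRing k] (p : ℕ) [CharP k p] (i : Fin 2)
    (N : Matrix (Fin p) (Fin p) (MvPolynomial (Fin 2) k))
    (hx : N * splitting k p (x k) - splitting k p (x k) * N = if i = 0 then 1 else 0)
    (hy : N * splitting k p (y k) - splitting k p (y k) * N = if i = 1 then 1 else 0)
    (L : WeylAlgebra k) : MvPolynomial.pderiv i (pDet k p L) = 0 := by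
  let R := MvPolynomial (Fin 2) k
  let ι : Matrix (Fin p) (Fin p) R →ₐ[k] Matrix (Fin p) (Fin p) (TrivSqZeroExt R R) :=
    (TrivSqZeroExt.inlAlgHom k R R).mapMatrix
  let e : Matrix (Fin p) (Fin p) (TrivSqZeroExt R R) :=
    Matrix.scalar (Fin p) (TrivSqZeroExt.inr (1 : R))
  have he : ∀ M, e * M = M * e := fun M =>
    (Matrix.scalar_commute _ (fun _ => Commute.all _ _) M).eq
  have hee : e * e = 0 := by
    simp only [e, ← map_mul, TrivSqZeroExt.inr_mul_inr, map_zero]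
  have key : ∀ A B : Matrix (Fin p) (Fin p) (TrivSqZeroExt R R), A * e * (B * e) = 0 := by
    intro A B
    rw [mul_assoc, ← mul_assoc e, he, mul_assoc B, hee]; simp
  let U := 1 + ι N * e
  let V := 1 - ι N * e
  have hUV : V * U = 1 := by
    simp only [U, V, sub_mul, mul_add, key, one_mul, mul_one]; abel
  have hVU : U * V = 1 := by
    simp only [U, V, add_mul, mul_sub, key, one_mul, mul_one]; abel
  let β : WeylAlgebra k →ₐ[k] Matrix (Fin p) (Fin p) (TrivSqZeroExt R R) :=
    AlgHom.ofLinearMap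
      ((LinearMap.mulLeft k U).comp ((LinearMap.mulRight k V).comp
        (ι.comp (splitting k p)).toLinearMap))
      (by simp [hVU])
      (by
        intro a b
        simp only [LinearMap.comp_apply, LinearMap.mulLeft_apply, LinearMap.mulRight_apply,
          AlgHom.toLinearMap_apply, map_mul]
        calc _ = U * (ι.comp (splitting k p) a * 1 * ι.comp (splitting k p) b) * V := by
              simp only [mul_one, mul_assoc]
          _ = _ := by rw [← hUV]; simp only [mul_assoc])
  have hβ : ∀ a, β a = ι (splitting k p a) +
      ι (N * splitting k p a - splitting k p a * N) * e := by
    intro a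
    change U * (ι (splitting k p a) * V) = _
    have h1 : ∀ M, ι N * e * (M * (ι N * e)) = 0 := fun M => by
      rw [← mul_assoc M]; exact key _ _
    simp only [U, V, add_mul, mul_sub, h1, one_mul, mul_one, map_sub, map_mul, sub_mul]
    rw [mul_assoc (ι N) e, he, ← mul_assoc, ← mul_assoc]
    abel
  have hshift : ∀ j : Fin 2, ∀ M : Matrix (Fin p) (Fin p) k,
      (dualShift k i).mapMatrix
        (M.map MvPolynomial.C + Matrix.scalar (Fin p) (MvPolynomial.X j)) =
      ι (M.map MvPolynomial.C + Matrix.scalar (Fin p) (MvPolynomial.X j)) +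
      ι (if i = j then 1 else 0) * e := by
    intro j M
    ext1 a b
    have hd : (ι (if i = j then 1 else 0) * e) a b =
        TrivSqZeroExt.inr (if a = b then (if i = j then 1 else 0) else 0) := by
      split_ifs <;> simp [e, *]
    rw [Matrix.add_apply, hd]
    change dualShift k i _ = TrivSqZeroExt.inl _ + _
    rw [dualShift_apply]
    congr 2
    by_cases hab : a = b
    · subst hab
      by_cases hij : i = j
      · subst hij; simp
      · simp [hij, MvPolynomial.pderiv_X_of_ne (Ne.symm hij)]
    · simp [hab]
  have hαβ : (dualShift k i).mapMatrix.comp (splitting k p) = β := by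
    apply hom_ext
    · rw [hβ, hx, AlgHom.comp_apply, splitting_x, hshift]
    · rw [hβ, hy, AlgHom.comp_apply, splitting_y, hshift]
  have h := congrArg Matrix.det (DFunLike.congr_fun hαβ L)
  have h2 : (β L).det = (ι (splitting k p L)).det := by
    change (U * (ι (splitting k p L) * V)).det = _
    rw [Matrix.det_mul, Matrix.det_mul, mul_left_comm, ← Matrix.det_mul, hVU, Matrix.det_one,
      mul_one]
  rw [h2, AlgHom.comp_apply, ← AlgHom.map_det, ← AlgHom.map_det, dualShift_apply] at h
  have h3 := congrArg TrivSqZeroExt.snd h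
  simpa [pDet] using h3

theorem pderiv_pDet (k : Type*) [CommRing k] (p : ℕ) [CharP k p] (i : Fin 2)
    (L : WeylAlgebra k) : MvPolynomial.pderiv i (pDet k p L) = 0 := by
  have hc : splitting k p (y k) * splitting k p (x k) -
      splitting k p (x k) * splitting k p (y k) = 1 := by
    rw [← map_mul, ← map_mul, ← map_sub, ← map_one (splitting k p)]
    congr 1
    have := RingQuot.mkAlgHom_rel k (WeylRel.comm (k := k))
    simpa [x, y] using this
  fin_cases i
  · refine pderiv_pDet_of_conj k p 0 (splitting k p (y k)) ?_ ?_ L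
    · simpa using hc
    · simp
  · refine pderiv_pDet_of_conj k p 1 (-splitting k p (x k)) ?_ ?_ L
    · simp
    · rw [if_pos rfl, ← hc]; noncomm_ring

/-- The `p`-determinant is a polynomial in `x̃^p` and `ỹ^p`. -/
theorem exists_expand_eq_pDet (k : Type*) [CommRing k] [NoZeroDivisors k] (p : ℕ) [Fact p.Prime]
    [CharP k p] (L : WeylAlgebra k) :
    ∃ f : MvPolynomial (Fin 2) k, MvPolynomial.expand p f = pDet k p L := by
  have hdvd : ∀ m : Fin 2 →₀ ℕ, MvPolynomial.coeff m (pDet k p L) ≠ 0 → ∀ i, p ∣ m i := by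
    intro m hm i
    by_contra hn
    have h0 : m i ≠ 0 := fun h => hn (h ▸ dvd_zero p)
    have h1 := congrArg (MvPolynomial.coeff (m - Finsupp.single i 1)) (pderiv_pDet k p i L)
    have h2 : m - Finsupp.single i 1 + Finsupp.single i 1 = m := by
      ext j
      by_cases hj : i = j
      · subst hj; simp; omega
      · simp [hj]
    rw [MvPolynomial.coeff_pderiv, h2, MvPolynomial.coeff_zero] at h1
    have h3 : (((m - Finsupp.single i 1 : Fin 2 →₀ ℕ) i : ℕ) : k) + 1 = ((m i : ℕ) : k) := by
      rw [← Nat.cast_add_one]; congr 1; simp; omega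
    rw [h3] at h1
    rcases mul_eq_zero.1 h1 with h | h
    · exact hm h
    · exact hn ((CharP.cast_eq_zero_iff k p _).1 h)
  refine ⟨∑ m ∈ (pDet k p L).support, MvPolynomial.monomial
    (m.mapRange (· / p) (Nat.zero_div p)) (MvPolynomial.coeff m (pDet k p L)), ?_⟩
  conv_rhs => rw [MvPolynomial.as_sum (pDet k p L)]
  rw [map_sum]
  refine Finset.sum_congr rfl fun m hm => ?_
  rw [MvPolynomial.expand_monomial]
  refine congrArg (fun n => MvPolynomial.monomial n _) (Finsupp.ext fun i => ?_)
  simpa using Nat.mul_div_cancel' (hdvd m (MvPolynomial.mem_support_iff.1 hm) i)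

/-! ### Degree and non-vanishing of the `p`-determinant -/

theorem homogeneousComponent_mul_top {k : Type*} [CommRing k] {m n : ℕ}
    {f g : MvPolynomial (Fin 2) k} (hf : f.totalDegree ≤ m) (hg : g.totalDegree ≤ n) :
    MvPolynomial.homogeneousComponent (m + n) (f * g) =
      MvPolynomial.homogeneousComponent m f * MvPolynomial.homogeneousComponent n g := by
  have hs : ∀ {f : MvPolynomial (Fin 2) k} {m : ℕ}, f.totalDegree ≤ m →
      f = ∑ i ∈ Finset.range (m + 1), MvPolynomial.homogeneousComponent i f := by
    intro f m hf
    conv_lhs => rw [← MvPolynomial.sum_homogeneousComponent f]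
    refine Finset.sum_subset (Finset.range_mono (by omega)) fun i _ hi => ?_
    exact MvPolynomial.homogeneousComponent_eq_zero _ _ (by simpa using hi)
  conv_lhs => rw [hs hf, hs hg, Finset.sum_mul_sum, map_sum]
  simp only [map_sum]
  rw [Finset.sum_eq_single m, Finset.sum_eq_single n]
  · rw [MvPolynomial.homogeneousComponent_of_mem ((MvPolynomial.homogeneousComponent_isHomogeneous
      m f).mul (MvPolynomial.homogeneousComponent_isHomogeneous n g)), if_pos rfl]
  · intro j hj hj'
    rw [MvPolynomial.homogeneousComponent_of_mem ((MvPolynomial.homogeneousComponent_isHomogeneous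
      m f).mul (MvPolynomial.homogeneousComponent_isHomogeneous j g)), if_neg (by omega)]
  · simp
  · intro i hi hi'
    refine Finset.sum_eq_zero fun j hj => ?_
    simp only [Finset.mem_range] at hi hj
    rw [MvPolynomial.homogeneousComponent_of_mem ((MvPolynomial.homogeneousComponent_isHomogeneous
      i f).mul (MvPolynomial.homogeneousComponent_isHomogeneous j g)), if_neg (by omega)]
  · simp

/-- The entries of `M` have degree at most `n`, and their part of degree `n` is `c I`. -/
def HasTop {k : Type*} [CommRing k] {p : ℕ} (n : ℕ) (c : MvPolynomial (Fin 2) k)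
    (M : Matrix (Fin p) (Fin p) (MvPolynomial (Fin 2) k)) : Prop :=
  ∀ a b, (M a b).totalDegree ≤ n ∧
    MvPolynomial.homogeneousComponent n (M a b) = if a = b then c else 0

theorem HasTop.mul {k : Type*} [CommRing k] {p m n : ℕ} {c d : MvPolynomial (Fin 2) k}
    {M N : Matrix (Fin p) (Fin p) (MvPolynomial (Fin 2) k)} (hM : HasTop m c M)
    (hN : HasTop n d N) : HasTop (m + n) (c * d) (M * N) := by
  intro a b
  rw [Matrix.mul_apply]
  refine ⟨MvPolynomial.totalDegree_finsetSum_le fun i _ =>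
    (MvPolynomial.totalDegree_mul _ _).trans (add_le_add (hM a i).1 (hN i b).1), ?_⟩
  rw [map_sum]
  simp only [homogeneousComponent_mul_top (hM _ _).1 (hN _ _).1, (hM _ _).2, (hN _ _).2]
  simp

theorem HasTop.one {k : Type*} [CommRing k] {p : ℕ} :
    HasTop 0 1 (1 : Matrix (Fin p) (Fin p) (MvPolynomial (Fin 2) k)) := by
  intro a b
  rw [Matrix.one_apply]
  split_ifs <;> simp

theorem HasTop.pow {k : Type*} [CommRing k] {p m : ℕ} {c : MvPolynomial (Fin 2) k}
    {M : Matrix (Fin p) (Fin p) (MvPolynomial (Fin 2) k)} (hM : HasTop m c M) (j : ℕ) :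
    HasTop (j * m) (c ^ j) (M ^ j) := by
  induction j with
  | zero => simpa using HasTop.one
  | succ j ih => simpa [pow_succ, add_mul] using ih.mul hM

theorem HasTop.add {k : Type*} [CommRing k] {p n : ℕ} {c d : MvPolynomial (Fin 2) k}
    {M N : Matrix (Fin p) (Fin p) (MvPolynomial (Fin 2) k)} (hM : HasTop n c M)
    (hN : HasTop n d N) : HasTop n (c + d) (M + N) := by
  intro a b
  rw [Matrix.add_apply]
  refine ⟨(MvPolynomial.totalDegree_add _ _).trans (max_le (hM a b).1 (hN a b).1), ?_⟩
  rw [map_add, (hM a b).2, (hN a b).2]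
  split_ifs <;> simp

theorem HasTop.smul {k : Type*} [CommRing k] {p n : ℕ} {c : MvPolynomial (Fin 2) k}
    {M : Matrix (Fin p) (Fin p) (MvPolynomial (Fin 2) k)} (hM : HasTop n c M) (r : k) :
    HasTop n (r • c) (r • M) := by
  intro a b
  rw [Matrix.smul_apply]
  refine ⟨(MvPolynomial.totalDegree_smul_le _ _).trans (hM a b).1, ?_⟩
  rw [map_smul, (hM a b).2]
  split_ifs <;> simp

theorem HasTop.zero {k : Type*} [CommRing k] {p n : ℕ} :
    HasTop n 0 (0 : Matrix (Fin p) (Fin p) (MvPolynomial (Fin 2) k)) := by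
  intro a b
  simp

theorem HasTop.of_lt {k : Type*} [CommRing k] {p m n : ℕ} {c : MvPolynomial (Fin 2) k}
    {M : Matrix (Fin p) (Fin p) (MvPolynomial (Fin 2) k)} (hM : HasTop m c M) (h : m < n) :
    HasTop n 0 M := by
  intro a b
  refine ⟨(hM a b).1.trans h.le, ?_⟩
  rw [MvPolynomial.homogeneousComponent_eq_zero _ _ ((hM a b).1.trans_lt h)]
  simp

theorem HasTop.scalar_X {k : Type*} [CommRing k] {p : ℕ} (M : Matrix (Fin p) (Fin p) k)
    (i : Fin 2) :
    HasTop 1 (MvPolynomial.X i)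
      (M.map MvPolynomial.C + Matrix.scalar (Fin p) (MvPolynomial.X i)) := by
  have h0 : HasTop 1 0 (M.map (MvPolynomial.C : k →+* MvPolynomial (Fin 2) k)) := by
    intro a b
    refine ⟨by simp, ?_⟩
    rw [MvPolynomial.homogeneousComponent_eq_zero _ _ (by simp)]
    simp
  have h1 : HasTop 1 (MvPolynomial.X i : MvPolynomial (Fin 2) k)
      (Matrix.scalar (Fin p) (MvPolynomial.X i)) := by
    intro a b
    by_cases hab : a = b
    · subst hab
      have hX := MvPolynomial.isHomogeneous_X k i
      simp only [Matrix.scalar_apply, Matrix.diagonal_apply_eq, if_true]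
      exact ⟨hX.totalDegree_le, by rw [MvPolynomial.homogeneousComponent_of_mem hX, if_pos rfl]⟩
    · simp [hab]
  simpa using h0.add h1

theorem HasTop.det {k : Type*} [CommRing k] {p n : ℕ} {c : MvPolynomial (Fin 2) k}
    {M : Matrix (Fin p) (Fin p) (MvPolynomial (Fin 2) k)} (hM : HasTop n c M) :
    M.det.totalDegree ≤ p * n ∧ MvPolynomial.homogeneousComponent (p * n) M.det = c ^ p := by
  have hprod : ∀ (f g : Fin p → Fin p) (s : Finset (Fin p)),
      (∏ i ∈ s, M (f i) (g i)).totalDegree ≤ s.card * n ∧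
      MvPolynomial.homogeneousComponent (s.card * n) (∏ i ∈ s, M (f i) (g i)) =
        ∏ i ∈ s, (c • (1 : Matrix (Fin p) (Fin p) (MvPolynomial (Fin 2) k))) (f i) (g i) := by
    intro f g s
    induction s using Finset.induction_on with
    | empty => simp
    | insert a s ha ih =>
      rw [Finset.prod_insert ha, Finset.prod_insert ha, Finset.card_insert_of_notMem ha,
        add_mul, one_mul, add_comm]
      refine ⟨(MvPolynomial.totalDegree_mul _ _).trans (add_le_add (hM _ _).1 ih.1), ?_⟩
      rw [homogeneousComponent_mul_top (hM _ _).1 ih.1, ih.2, (hM _ _).2]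
      simp [Matrix.one_apply]
  have hsmul : ∀ (σ : Equiv.Perm (Fin p)) (f : MvPolynomial (Fin 2) k),
      Equiv.Perm.sign σ • f = ((Equiv.Perm.sign σ : ℤ) : k) • f := by
    intro σ f
    rw [Units.smul_def, Int.cast_smul_eq_zsmul]
  have hone : c ^ p = (c • (1 : Matrix (Fin p) (Fin p) (MvPolynomial (Fin 2) k))).det := by
    simp
  rw [hone, Matrix.det_apply, Matrix.det_apply]
  constructor
  · refine MvPolynomial.totalDegree_finsetSum_le fun σ _ => ?_
    rw [hsmul]
    refine (MvPolynomial.totalDegree_smul_le _ _).trans ?_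
    simpa using (hprod (fun i => σ i) (fun i => i) Finset.univ).1
  · rw [map_sum]
    refine Finset.sum_congr rfl fun σ _ => ?_
    have h := (hprod (fun i => σ i) (fun i => i) Finset.univ).2
    rw [Finset.card_univ, Fintype.card_fin] at h
    rw [hsmul, hsmul, map_smul, h]

/-- The operator `∑ a_{ij} x^i y^j` with the coefficients of the polynomial `∑ a_{ij} X_0^i X_1^j`. -/
def normalOrder (k : Type*) [CommRing k] : MvPolynomial (Fin 2) k →ₗ[k] WeylAlgebra k :=
  (MvPolynomial.basisMonomials (Fin 2) k).constr k fun m => x k ^ m 0 * y k ^ m 1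

theorem normalOrder_monomial (k : Type*) [CommRing k] (m : Fin 2 →₀ ℕ) (r : k) :
    normalOrder k (MvPolynomial.monomial m r) = r • (x k ^ m 0 * y k ^ m 1) := by
  have h : MvPolynomial.monomial m r = r • MvPolynomial.basisMonomials (Fin 2) k m := by
    simp [MvPolynomial.smul_monomial]
  rw [h, map_smul, normalOrder, Module.Basis.constr_basis]

theorem exists_normalOrder_eq (k : Type*) [CommRing k] (d : ℕ) (L : WeylAlgebra k)
    (hL : L ∈ bernstein k d) :
    ∃ f : MvPolynomial (Fin 2) k, f.totalDegree ≤ d ∧ normalOrder k f = L := by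
  have h : bernstein k d ≤
      (MvPolynomial.restrictTotalDegree (Fin 2) k d).map (normalOrder k) := by
    refine Submodule.span_le.2 ?_
    rintro _ ⟨i, j, hij, rfl⟩
    refine ⟨MvPolynomial.monomial (Finsupp.single 0 i + Finsupp.single 1 j) 1, ?_, ?_⟩
    · rw [SetLike.mem_coe, MvPolynomial.mem_restrictTotalDegree]
      refine (MvPolynomial.totalDegree_monomial_le _ _).trans ?_
      rw [Finsupp.sum_fintype _ _ (fun _ => rfl)]
      simpa [Fin.sum_univ_two] using hij
    · simp [normalOrder_monomial]
  obtain ⟨f, hf, rfl⟩ := h hL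
  exact ⟨f, (MvPolynomial.mem_restrictTotalDegree _ _ _).1 hf, rfl⟩

theorem hasTop_normalOrder (k : Type*) [CommRing k] (p : ℕ) [CharP k p] (n : ℕ)
    (f : MvPolynomial (Fin 2) k) (hf : f.totalDegree ≤ n) :
    HasTop n (MvPolynomial.homogeneousComponent n f) (splitting k p (normalOrder k f)) := by
  have hmon : ∀ m : Fin 2 →₀ ℕ, ∀ r : k, m.degree ≤ n →
      HasTop n (MvPolynomial.homogeneousComponent n (MvPolynomial.monomial m r))
        (splitting k p (normalOrder k (MvPolynomial.monomial m r))) := by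
    intro m r hm
    have hd : m 0 + m 1 = m.degree := by
      rw [Finsupp.degree_eq_sum, Fin.sum_univ_two]
    have h1 : HasTop m.degree (MvPolynomial.monomial m r)
        (splitting k p (normalOrder k (MvPolynomial.monomial m r))) := by
      have := (((HasTop.scalar_X (matX k p) 0).pow (m 0)).mul
        ((HasTop.scalar_X (matY k p) 1).pow (m 1))).smul r
      rw [← splitting_x, ← splitting_y, ← map_pow, ← map_pow, ← map_mul, ← map_smul,
        ← normalOrder_monomial, mul_one, mul_one, hd] at this
      convert this using 1
      rw [MvPolynomial.monomial_eq, Finsupp.prod_fintype _ _ (fun _ => pow_zero _),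
        Fin.prod_univ_two, MvPolynomial.smul_eq_C_mul]
    have hh : (MvPolynomial.monomial m r).IsHomogeneous m.degree :=
      MvPolynomial.isHomogeneous_monomial r rfl
    rw [MvPolynomial.homogeneousComponent_of_mem hh]
    rcases hm.lt_or_eq with h | h
    · rw [if_neg (by omega)]
      exact h1.of_lt h
    · rw [if_pos h.symm, ← h]
      exact h1
  have hsum : ∀ s : Finset (Fin 2 →₀ ℕ), s ⊆ f.support →
      HasTop n (MvPolynomial.homogeneousComponent n
        (∑ m ∈ s, MvPolynomial.monomial m (MvPolynomial.coeff m f)))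
        (splitting k p (normalOrder k
          (∑ m ∈ s, MvPolynomial.monomial m (MvPolynomial.coeff m f)))) := by
    intro s
    induction s using Finset.induction_on with
    | empty => intro _; simpa using HasTop.zero
    | insert a s ha ih =>
      intro hs
      rw [Finset.sum_insert ha, map_add, map_add, map_add]
      refine (hmon _ _ ?_).add (ih fun _ h => hs (Finset.mem_insert_of_mem h))
      refine le_trans ?_ hf
      have := MvPolynomial.le_totalDegree (hs (Finset.mem_insert_self a s))
      exact this
  have := hsum f.support subset_rfl
  rwa [← MvPolynomial.as_sum f] at this

theorem totalDegree_pDet_le (k : Type*) [CommRing k] (p : ℕ) [CharP k p] (d : ℕ)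
    (L : WeylAlgebra k) (hL : L ∈ bernstein k d) : (pDet k p L).totalDegree ≤ p * d := by
  obtain ⟨f, hf, rfl⟩ := exists_normalOrder_eq k d L hL
  exact (hasTop_normalOrder k p d f hf).det.1

theorem pDet_ne_zero (k : Type*) [CommRing k] [IsDomain k] (p : ℕ) [CharP k p] (d : ℕ)
    (L : WeylAlgebra k) (hL : L ∈ bernstein k d) (h0 : L ≠ 0) : pDet k p L ≠ 0 := by
  obtain ⟨f, hf, rfl⟩ := exists_normalOrder_eq k d L hL
  have hf0 : f ≠ 0 := by rintro rfl; simp at h0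
  intro h
  have h1 := (hasTop_normalOrder k p f.totalDegree f le_rfl).det.2
  rw [← pDet, h, map_zero] at h1
  have h2 : MvPolynomial.homogeneousComponent f.totalDegree f = 0 := by
    by_contra hne
    exact pow_ne_zero p hne h1.symm
  obtain ⟨m, hm, hm'⟩ := f.support.exists_mem_eq_sup
    (MvPolynomial.support_nonempty.2 hf0) (fun m => m.sum fun _ e => e)
  have h3 := congrArg (MvPolynomial.coeff m) h2
  rw [MvPolynomial.coeff_homogeneousComponent, if_pos, MvPolynomial.coeff_zero] at h3
  · exact MvPolynomial.mem_support_iff.1 hm h3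
  · rw [MvPolynomial.totalDegree, hm']
    rfl

/-! ### The curve of an operator -/

section Curve

variable (k : Type*) [Field k] (p : ℕ) [Fact p.Prime] [CharP k p]

/-- The `p`-determinant as a polynomial in `z₁ = x̃^p` and `z₂ = ỹ^p`. It is the unique
polynomial satisfying `expand_curvePoly`, because `MvPolynomial.expand p` is injective. -/
def curvePoly (L : WeylAlgebra k) : MvPolynomial (Fin 2) k :=
  (exists_expand_eq_pDet k p L).choose

theorem expand_curvePoly (L : WeylAlgebra k) :
    MvPolynomial.expand p (curvePoly k p L) = pDet k p L :=
  (exists_expand_eq_pDet k p L).choose_spec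

theorem curvePoly_smul (c : k) (L : WeylAlgebra k) :
    curvePoly k p (c • L) = c ^ p • curvePoly k p L := by
  apply MvPolynomial.expand_injective (Fact.out : p.Prime).pos
  rw [map_smul, expand_curvePoly, expand_curvePoly, pDet_smul]

theorem curvePoly_mem {d : ℕ} {L : WeylAlgebra k} (hL : L ∈ bernstein k d) :
    curvePoly k p L ∈ MvPolynomial.restrictTotalDegree (Fin 2) k d := by
  rw [MvPolynomial.mem_restrictTotalDegree]
  have h := totalDegree_pDet_le k p d L hL
  rw [← expand_curvePoly, MvPolynomial.totalDegree_expand, mul_comm] at h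
  exact Nat.le_of_mul_le_mul_left h (Fact.out : p.Prime).pos

theorem curvePoly_ne_zero {d : ℕ} {L : WeylAlgebra k} (hL : L ∈ bernstein k d) (h0 : L ≠ 0) :
    curvePoly k p L ≠ 0 := by
  intro h
  apply pDet_ne_zero k p d L hL h0
  rw [← expand_curvePoly, h, map_zero]

end Curve

end WeylAlgebra

/-! ### Operators and planar curves modulo scalars, and the map `Θ` -/

/-- `F_d / k^×`: operators of degree at most `d` modulo non-zero constants. -/
abbrev OperatorSpace (k : Type*) [Field k] (d : ℕ) : Type _ :=
  ℙ k (WeylAlgebra.bernstein k d)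

/-- `𝔠_d`: planar algebraic curves of degree at most `d`, a curve being a non-zero polynomial in
`z₁ = X 0` and `z₂ = X 1` modulo non-zero constants. -/
abbrev CurveSpace (k : Type*) [Field k] (d : ℕ) : Type _ :=
  ℙ k (MvPolynomial.restrictTotalDegree (Fin 2) k d)

/-- The embedding of projective spaces induced by an inclusion of subspaces. -/
def projInclusion {k V : Type*} [Field k] [AddCommGroup V] [Module k V] {S T : Submodule k V}
    (h : S ≤ T) : ℙ k S ↪ ℙ k T where
  toFun := Projectivization.map (Submodule.inclusion h) (Submodule.inclusion_injective h)
  inj' := Projectivization.map_injective _ _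

theorem restrictTotalDegree_mono (k : Type*) [Field k] :
    Monotone (MvPolynomial.restrictTotalDegree (Fin 2) k) := fun _ _ h _ hf =>
  (MvPolynomial.mem_restrictTotalDegree _ _ _).2
    (((MvPolynomial.mem_restrictTotalDegree _ _ _).1 hf).trans h)

/-- The transition maps `μ_{dd'} : F_d / k^× → F_{d'} / k^×`. -/
def operatorEmb (k : Type*) [Field k] (d d' : ℕ) (h : d ≤ d') :
    OperatorSpace k d ↪ OperatorSpace k d' :=
  projInclusion (WeylAlgebra.bernstein_mono k h)

/-- The transition maps `ν_{dd'} : 𝔠_d → 𝔠_{d'}`. -/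
def curveEmb (k : Type*) [Field k] (d d' : ℕ) (h : d ≤ d') :
    CurveSpace k d ↪ CurveSpace k d' :=
  projInclusion (restrictTotalDegree_mono k h)

instance (k : Type*) [Field k] : DirectedSystem (OperatorSpace k) (operatorEmb k · · ·) where
  map_self _ q := by induction q using Projectivization.ind with | h v hv => rfl
  map_map _ _ _ _ _ q := by induction q using Projectivization.ind with | h v hv => rfl

instance (k : Type*) [Field k] : DirectedSystem (CurveSpace k) (curveEmb k · · ·) where
  map_self _ q := by induction q using Projectivization.ind with | h v hv => rfl
  map_map _ _ _ _ _ q := by induction q using Projectivization.ind with | h v hv => rfl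

/-- `A_{1,k} / k^×`, the direct limit of the projective spaces `F_d / k^×`. -/
abbrev IndOperatorSpace (k : Type*) [Field k] : Type _ :=
  DirectLimit (OperatorSpace k) (operatorEmb k)

/-- The space of all planar algebraic curves, the direct limit of the projective spaces `𝔠_d`. -/
abbrev IndCurveSpace (k : Type*) [Field k] : Type _ :=
  DirectLimit (CurveSpace k) (curveEmb k)

section Theta

variable (k : Type*) [Field k] (p : ℕ) [Fact p.Prime] [CharP k p]

/-- `Θ_d : F_d / k^× → 𝔠_d`, sending the class of `L` to the curve cut out by the
`p`-determinant of `L` in the variables `z₁ = x̃^p`, `z₂ = ỹ^p`. -/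
def thetaDeg (d : ℕ) : OperatorSpace k d → CurveSpace k d :=
  Projectivization.lift
    (fun L => Projectivization.mk k
      (⟨WeylAlgebra.curvePoly k p L.1, WeylAlgebra.curvePoly_mem k p L.1.2⟩ :
        MvPolynomial.restrictTotalDegree (Fin 2) k d)
      (fun h => WeylAlgebra.curvePoly_ne_zero k p L.1.2
        (fun h' => L.2 (Subtype.ext h')) (congrArg Subtype.val h)))
    (by
      rintro ⟨a, ha⟩ ⟨b, hb⟩ t h
      rw [Projectivization.mk_eq_mk_iff']
      refine ⟨t ^ p, Subtype.ext ?_⟩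
      dsimp only at h
      subst h
      exact (WeylAlgebra.curvePoly_smul k p t _).symm)

theorem curveEmb_thetaDeg (d d' : ℕ) (h : d ≤ d') (q : OperatorSpace k d) :
    curveEmb k d d' h (thetaDeg k p d q) = thetaDeg k p d' (operatorEmb k d d' h q) := by
  induction q using Projectivization.ind with | h v hv => rfl

/-- `Θ : A_{1,k} / k^× → 𝔠(𝔸²)`, the direct limit of the maps `Θ_d`. -/
def theta : IndOperatorSpace k → IndCurveSpace k :=
  DirectLimit.map (operatorEmb k) (curveEmb k) (thetaDeg k p) (curveEmb_thetaDeg k p)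

end Theta

/-- A map of projective spaces (sets of points over an algebraically closed field `k`) is a
morphism if it is given, in homogeneous coordinates, by homogeneous polynomials of one and the same degree without a common zero (a notion independent
of the choice of coordinates). -/
def IsProjMorphism {k V W : Type*} [Field k] [AddCommGroup V] [Module k V] [Module.Finite k V]
    [AddCommGroup W] [Module k W] [Module.Finite k W] (φ : ℙ k V → ℙ k W) : Prop :=
  ∃ (e : ℕ) (F : Fin (Module.finrank k W) → MvPolynomial (Fin (Module.finrank k V)) k),
    (∀ j, (F j).IsHomogeneous e) ∧
    ∀ (v : V) (hv : v ≠ 0),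
      ∃ hw : ∑ j, MvPolynomial.eval ((Module.finBasis k V).repr v) (F j) • Module.finBasis k W j ≠ 0,
        φ (Projectivization.mk k v hv) = Projectivization.mk k _ hw

end

/- `Det_p` is given by forms of degree `p` from `F_d` to the polynomials of degree at most `d` in
`z₁, z₂`, a space of the same dimension `N`. The line spanned by a target polynomial is cut out by
`N - 1` linear equations; pulled back to `F_d` these are `N - 1` forms in `N` variables, which have
a common zero besides the origin, because by Krull's height theorem they cannot cut out a maximal
ideal, of height `N`. The image of this zero lies on the given line, and it is not `0` because
`Det_p` has no nontrivial zero. -/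

theorem height_eq_natCard_of_isMaximal {k σ : Type*} [Field k] [Finite σ]
    (M : Ideal (MvPolynomial σ k)) [M.IsMaximal] : M.height = Nat.card σ := by
  induction σ using Finite.induction_empty_option with
  | of_equiv e ih =>
    let E := (MvPolynomial.renameEquiv k e).toRingEquiv
    have : (M.comap E).IsMaximal := Ideal.comap_isMaximal_of_equiv E
    rw [← E.height_comap M, ih (M.comap E), Nat.card_congr e]
  | h_empty =>
    let E := (MvPolynomial.isEmptyRingEquiv k PEmpty).symm
    have : (M.comap E).IsMaximal := Ideal.comap_isMaximal_of_equiv E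
    rw [← E.height_comap M, Ideal.eq_bot_of_prime (M.comap E), Ideal.height_bot,
      Nat.card_of_isEmpty, Nat.cast_zero]
  | @h_option α _ ih =>
    let E := (MvPolynomial.optionEquivLeft k α).symm.toRingEquiv
    have : (M.comap E).IsMaximal := Ideal.comap_isMaximal_of_equiv E
    have := Polynomial.isMaximal_comap_C_of_isJacobsonRing (M.comap E)
    have : (M.comap E).LiesOver ((M.comap E).comap Polynomial.C) := ⟨rfl⟩
    rw [← E.height_comap M,
      Polynomial.height_eq_height_add_one ((M.comap E).comap Polynomial.C), ih,
      Finite.card_option, Nat.cast_add_one]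

open MvPolynomial in
theorem exists_ne_eval_eq_zero {k σ ι : Type*} [Field k] [IsAlgClosed k] [Finite σ] [Finite ι]
    (h : Nat.card ι < Nat.card σ) (F : ι → MvPolynomial σ k) {x : σ → k}
    (hx : ∀ i, eval x (F i) = 0) : ∃ y ≠ x, ∀ i, eval y (F i) = 0 := by
  by_contra! hF
  let I := Ideal.span (Set.range F)
  have hzero : zeroLocus k I = {x} := by
    ext y
    simp only [I, zeroLocus_span, Set.forall_mem_range, Set.mem_ofPred_eq,
      Set.mem_singleton_iff]
    exact ⟨fun hy => by_contra fun hyx => (hF y hyx).elim fun i hi => hi (hy i), fun hy => hy ▸ hx⟩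
  have hmin : vanishingIdeal k {x} ∈ I.minimalPrimes := by
    rw [← Ideal.radical_minimalPrimes, ← vanishingIdeal_zeroLocus_eq_radical (K := k), hzero,
      Ideal.minimalPrimes_eq_subsingleton_self]
    rfl
  have hle := Ideal.height_le_card_of_mem_minimalPrimes_span (Set.finite_range F) hmin
  rw [height_eq_natCard_of_isMaximal, Nat.cast_le] at hle
  exact h.not_ge (hle.trans (Finite.card_range_le F))

section HomogeneousMap

variable {ι k V W : Type*} [CommSemiring k] [AddCommMonoid V] [Module k V] [AddCommMonoid W]
  [Module k W]

/-- The map `ψ : V → W` is given, in the coordinates of the basis `b`, by homogeneous polynomials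
of degree `e`. Testing against all linear functionals avoids the choice of a basis of `W`. -/
def IsHomogeneousMap (b : Module.Basis ι k V) (e : ℕ) (ψ : V → W) : Prop :=
  ∀ l : W →ₗ[k] k, ∃ F : MvPolynomial ι k,
    F.IsHomogeneous e ∧ ∀ v, MvPolynomial.eval (b.repr v) F = l (ψ v)

theorem IsHomogeneousMap.linearMap_comp {U : Type*} [AddCommMonoid U] [Module k U]
    {b : Module.Basis ι k V} {e : ℕ} {ψ : V → W} (hψ : IsHomogeneousMap b e ψ) (f : W →ₗ[k] U) :
    IsHomogeneousMap b e (f ∘ ψ) :=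
  fun l => hψ (l ∘ₗ f)

open MvPolynomial in
theorem isHomogeneousMap_eval {R : Type*} [CommSemiring R] [Algebra k R] (b : Module.Basis ι k V)
    {e : ℕ} {Q : MvPolynomial ι R} (hQ : Q.IsHomogeneous e) :
    IsHomogeneousMap b e fun v => eval (fun i => algebraMap k R (b.repr v i)) Q := by
  intro l
  refine ⟨∑ m ∈ Q.support, monomial m (l (coeff m Q)), ?_, fun v => ?_⟩
  · refine IsHomogeneous.sum _ _ _ fun m hm => isHomogeneous_monomial _ ?_
    by_contra h
    exact mem_support_iff.1 hm (hQ.coeff_eq_zero h)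
  · beta_reduce
    rw [map_sum, eval_eq, map_sum]
    refine Finset.sum_congr rfl fun m _ => ?_
    simp_rw [← map_pow]
    rw [eval_monomial, ← map_prod, mul_comm (coeff m Q), ← Algebra.smul_def, map_smul,
      smul_eq_mul, mul_comm]
    rfl

theorem isHomogeneous_det {σ n R : Type*} [CommRing R] [Fintype n] [DecidableEq n]
    {e : ℕ} {M : Matrix n n (MvPolynomial σ R)} (hM : ∀ a b, (M a b).IsHomogeneous e) :
    M.det.IsHomogeneous (Fintype.card n * e) := by
  rw [Matrix.det_apply]
  refine MvPolynomial.IsHomogeneous.sum _ _ _ fun τ _ => ?_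
  have hprod : (∏ i, M (τ i) i).IsHomogeneous (Fintype.card n * e) := by
    simpa using MvPolynomial.IsHomogeneous.prod Finset.univ (fun i => M (τ i) i) (fun _ => e)
      fun i _ => hM _ _
  exact (MvPolynomial.homogeneousSubmodule σ R _).toAddSubgroup.zsmul_mem hprod _

open MvPolynomial in
theorem isHomogeneousMap_det [Finite ι] {n R : Type*} [Fintype n] [DecidableEq n] [CommRing R]
    [Algebra k R] (b : Module.Basis ι k V) (f : V →ₗ[k] Matrix n n R) :
    IsHomogeneousMap b (Fintype.card n) fun v => (f v).det := by
  cases nonempty_fintype ι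
  let M : Matrix n n (MvPolynomial ι R) := Matrix.of fun r s => ∑ i, C (f (b i) r s) * X i
  have hM : M.det.IsHomogeneous (Fintype.card n) := by
    simpa using isHomogeneous_det (e := 1) (M := M) fun r s =>
      IsHomogeneous.sum _ _ _ fun i _ => isHomogeneous_C_mul_X _ _
  convert! isHomogeneousMap_eval b hM using 2 with v
  rw [RingHom.map_det]
  congr 1
  ext r s
  conv_lhs => rw [← b.sum_repr v, map_sum, Matrix.sum_apply]
  simp [M, Algebra.smul_def, mul_comm]

end HomogeneousMap

namespace IsHomogeneousMap

variable {ι k V W : Type*} [Field k] [AddCommGroup V] [Module k V] [AddCommGroup W] [Module k W]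
  [Module.Finite k W] {e : ℕ} {ψ : V → W}

theorem exists_ne_zero_eq_zero [IsAlgClosed k] [Finite ι] {b : Module.Basis ι k V}
    (hψ : IsHomogeneousMap b e ψ) (he : e ≠ 0) (hlt : Module.finrank k W < Module.finrank k V) :
    ∃ v ≠ 0, ψ v = 0 := by
  let c := Module.finBasis k W
  choose F hF hFψ using fun j => hψ (c.coord j)
  have hF0 : ∀ j, MvPolynomial.eval 0 (F j) = 0 := fun j => by
    rw [MvPolynomial.eval_zero, MvPolynomial.constantCoeff_eq]
    exact (hF j).coeff_eq_zero (by simpa using he.symm)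
  obtain ⟨y, hy0, hy⟩ := exists_ne_eval_eq_zero
    (by rwa [Nat.card_fin, ← Module.finrank_eq_nat_card_basis b]) F hF0
  refine ⟨b.equivFun.symm y, by simpa using hy0, c.forall_coord_eq_zero_iff.1 fun j => ?_⟩
  rw [← hFψ, ← Module.Basis.equivFun_apply, LinearEquiv.apply_symm_apply, hy]

theorem surjective [IsAlgClosed k] [Module.Finite k V]
    (hψ : IsHomogeneousMap (Module.finBasis k V) e ψ) (he : e ≠ 0)
    (hle : Module.finrank k W ≤ Module.finrank k V) {φ : ℙ k V → ℙ k W}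
    (hφ : ∀ v hv, ∃ hw : ψ v ≠ 0, φ (.mk k v hv) = .mk k (ψ v) hw) :
    Function.Surjective φ := by
  intro q
  induction q using Projectivization.ind with
  | h w hw =>
    have hlt : Module.finrank k (W ⧸ k ∙ w) < Module.finrank k V := by
      have := Submodule.finrank_quotient_add_finrank (k ∙ w)
      rw [finrank_span_singleton hw] at this
      lia
    obtain ⟨v, hv, hvw⟩ := (hψ.linearMap_comp (k ∙ w).mkQ).exists_ne_zero_eq_zero he hlt
    obtain ⟨hv', hφv⟩ := hφ v hv
    obtain ⟨a, ha⟩ := Submodule.mem_span_singleton.1 ((Submodule.Quotient.mk_eq_zero _).1 hvw)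
    exact ⟨.mk k v hv, hφv.trans ((Projectivization.mk_eq_mk_iff' _ _ _ _ _).2 ⟨a, ha⟩)⟩

theorem isProjMorphism [Module.Finite k V]
    (hψ : IsHomogeneousMap (Module.finBasis k V) e ψ) {φ : ℙ k V → ℙ k W}
    (hφ : ∀ v hv, ∃ hw : ψ v ≠ 0, φ (.mk k v hv) = .mk k (ψ v) hw) :
    IsProjMorphism φ := by
  choose F hF hFψ using fun j => hψ ((Module.finBasis k W).coord j)
  refine ⟨e, F, hF, fun v hv => ?_⟩
  have hsum : ∑ j, MvPolynomial.eval ((Module.finBasis k V).repr v) (F j) •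
      Module.finBasis k W j = ψ v := by
    simp_rw [hFψ]
    exact (Module.finBasis k W).sum_repr (ψ v)
  simpa only [hsum] using hφ v hv

end IsHomogeneousMap

theorem eq_zero_of_homogeneousComponent_totalDegree_eq_zero {σ R : Type*} [CommSemiring R]
    {f : MvPolynomial σ R} (hf : MvPolynomial.homogeneousComponent f.totalDegree f = 0) :
    f = 0 := by
  by_contra hf0
  obtain ⟨m, hm, hdeg⟩ := f.support.exists_mem_eq_sup (MvPolynomial.support_nonempty.2 hf0)
    fun m => m.sum fun _ e => e
  refine MvPolynomial.mem_support_iff.1 hm ?_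
  rw [← MvPolynomial.coeff_zero m, ← hf, MvPolynomial.coeff_homogeneousComponent]
  exact (if_pos hdeg.symm).symm

namespace WeylAlgebra

theorem normalOrder_mem_bernstein {k : Type*} [CommRing k] {d : ℕ} {f : MvPolynomial (Fin 2) k}
    (hf : f.totalDegree ≤ d) : normalOrder k f ∈ bernstein k d := by
  rw [f.as_sum, map_sum]
  refine Submodule.sum_mem _ fun m hm => ?_
  rw [normalOrder_monomial]
  refine Submodule.smul_mem _ _ (Submodule.subset_span ⟨m 0, m 1, ?_, rfl⟩)
  have hdeg := (MvPolynomial.le_totalDegree hm).trans hf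
  rwa [Finsupp.sum_fintype _ _ fun _ => rfl, Fin.sum_univ_two] at hdeg

theorem normalOrder_injective (k : Type*) [CommRing k] (p : ℕ) [NeZero p] [CharP k p] :
    Function.Injective (normalOrder k) := by
  refine (injective_iff_map_eq_zero _).2 fun f hf =>
    eq_zero_of_homogeneousComponent_totalDegree_eq_zero ?_
  simpa [hf] using (hasTop_normalOrder k p f.totalDegree f le_rfl 0 0).2.symm

theorem finrank_restrictTotalDegree_le_finrank_bernstein (k : Type*) [Field k] (p : ℕ)
    [NeZero p] [CharP k p] (d : ℕ) :
    Module.finrank k (MvPolynomial.restrictTotalDegree (Fin 2) k d) ≤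
      Module.finrank k (bernstein k d) := by
  have hmap : ∀ f ∈ MvPolynomial.restrictTotalDegree (Fin 2) k d,
      normalOrder k f ∈ bernstein k d := fun f hf =>
    normalOrder_mem_bernstein ((MvPolynomial.mem_restrictTotalDegree _ _ _).1 hf)
  have hinj : Function.Injective ((normalOrder k).restrict hmap) := fun f g h =>
    Subtype.ext (normalOrder_injective k p (congrArg Subtype.val h))
  exact LinearMap.finrank_le_finrank_of_injective hinj

instance free_bernstein (k : Type*) [Field k] (d : ℕ) : Module.Free k (bernstein k d) :=
  Module.Free.of_divisionRing k (bernstein k d)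

section CurveMap

variable (k : Type*) [Field k] (p : ℕ) [Fact p.Prime] [CharP k p] (d : ℕ)

/-- The map `L ↦ Det_p(L)` from `F_d` to polynomials of degree at most `d` in `z₁, z₂`, which
induces `Θ_d` on the projective spaces. -/
noncomputable def curveMap (L : bernstein k d) : MvPolynomial.restrictTotalDegree (Fin 2) k d :=
  ⟨curvePoly k p L, curvePoly_mem k p L.2⟩

theorem isHomogeneousMap_curveMap {ι : Type*} [Finite ι]
    (b : Module.Basis ι k (bernstein k d)) :
    IsHomogeneousMap b p (curveMap k p d) := by
  let E := (MvPolynomial.expand p).toLinearMap ∘ₗ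
    (MvPolynomial.restrictTotalDegree (Fin 2) k d).subtype
  have hE : Function.Injective E :=
    (MvPolynomial.expand_injective (Fact.out : p.Prime).pos).comp Subtype.val_injective
  obtain ⟨r, hr⟩ := E.exists_leftInverse_of_injective (LinearMap.ker_eq_bot.2 hE)
  have hdet := isHomogeneousMap_det b ((splitting k p).toLinearMap.domRestrict (bernstein k d))
  rw [Fintype.card_fin] at hdet
  convert! hdet.linearMap_comp r using 1
  ext1 L
  have hEL : E (curveMap k p d L) = pDet k p L := expand_curvePoly k p L
  exact (LinearMap.congr_fun hr _).symm.trans (congrArg r hEL)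

end CurveMap

end WeylAlgebra

section ThetaDeg

variable (k : Type*) [Field k] (p : ℕ) [Fact p.Prime] [CharP k p] (d : ℕ)

theorem thetaDeg_mk (L : WeylAlgebra.bernstein k d) (hL : L ≠ 0) :
    ∃ hC : WeylAlgebra.curveMap k p d L ≠ 0,
      thetaDeg k p d (.mk k L hL) = .mk k (WeylAlgebra.curveMap k p d L) hC :=
  ⟨fun h => WeylAlgebra.curvePoly_ne_zero k p L.2 (fun h0 => hL (Subtype.ext h0))
    (congrArg Subtype.val h), rfl⟩

theorem isProjMorphism_thetaDeg : IsProjMorphism (thetaDeg k p d) :=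
  (WeylAlgebra.isHomogeneousMap_curveMap k p d
    (Module.finBasis k (WeylAlgebra.bernstein k d))).isProjMorphism (thetaDeg_mk k p d)

theorem surjective_thetaDeg [IsAlgClosed k] : Function.Surjective (thetaDeg k p d) :=
  have : NeZero p := ⟨(Fact.out : p.Prime).ne_zero⟩
  (WeylAlgebra.isHomogeneousMap_curveMap k p d
    (Module.finBasis k (WeylAlgebra.bernstein k d))).surjective (NeZero.ne p)
    (WeylAlgebra.finrank_restrictTotalDegree_le_finrank_bernstein k p d) (thetaDeg_mk k p d)

end ThetaDeg

theorem theorem3p6 (k : Type*) [Field k] [IsAlgClosed k] (p : ℕ) [Fact p.Prime] [CharP k p] :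
    (∀ d : ℕ, IsProjMorphism (thetaDeg k p d) ∧ Function.Surjective (thetaDeg k p d)) ∧
      Function.Surjective (theta k p) := by
  refine ⟨fun d => ⟨isProjMorphism_thetaDeg k p d, surjective_thetaDeg k p d⟩, fun q => ?_⟩
  induction q using DirectLimit.induction with
  | _ d q =>
    obtain ⟨L, rfl⟩ := surjective_thetaDeg k p d q
    exact ⟨⟦⟨d, L⟩⟧, rfl⟩
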